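/- Let $\mathcal{L}$ be a first-order language extending the language of rings, and let $\mathcal{K}$ be an $\mathcal{L}$-structure expanding a field $K$ of characteristic $0$, equipped with a field topology that is definable: there is an $\mathcal{L}$-formula $\chi(x,z)$, $z=(z_1,\dots,z_k)$, such that the sets $\chi(K,a)$, $a\in K^k$, form a basis of neighbourhoods of $0$. Let $\delta$ be a derivation on $K$ and write $\mathcal{K}_\delta$ for the expansion of $\mathcal{K}$ by $\delta$. An element $x$ of an elementary extension of $\mathcal{K}$ is called $K$-infinitesimal if it satisfies every $\mathcal{L}$-formula with parameters in $K$ that defines in $K$ an open set containing $0$. The field $K$ is large if every irreducible curve over $K$ with a smooth $K$-rational point has infinitely many $K$-rational points. The topological field $K$ is c-large if it is large and, for every $n\in\mathbb{N}$, there are a non-principal ultrapower $\mathcal{K}^*$ of $\mathcal{K}$ and an embedding over $K$ of the field $K((s_0,\dots,s_{n-1}))=\mathrm{Frac}\,K[[s_0,\dots,s_{n-1}]]$ into $K^*$ that maps the maximal ideal of $K[[s_0,\dots,s_{n-1}]]$ (the power series with zero constant term; in particular each $s_i$) into the $K$-infinitesimal elements of $K^*$. For a differential polynomial $P$ in one indeterminate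 $x$, of order $m\geq 0$, over a differential field $(F,\delta)$, let $P^*\in F[x_0,\dots,x_m]$ be the ordinary polynomial with $P(x)=P^*(x,\delta x,\dots,\delta^m x)$, and let $s_P=\partial P/\partial(\delta^m x)$ be its separant. An $\mathcal{L}$-structure $\mathcal F$ expanding a field $F$, together with a derivation $\delta$ of $F$, is a model of the scheme (DL) if for every such $P$ over $F$, all $u_0,\dots,u_m\in F^k$ and every $y\in F^{m+1}$ with $P^*(y)=0$ and $s_P^*(y)\neq 0$, there is $x\in F$ with $P(x)=0$, $s_P(x)\neq 0$ and $\delta^i(x)-y_i\in\chi(F,u_i)$ for $0\le i\le m$. Proposition. If $K$ is c-large, then $\mathcal{K}_\delta$ embeds (by an $\mathcal{L}$-embedding commuting with the derivations) into a structure $\mathcal{K}'_{\delta'}$, where $\mathcal{K}'$ expands a field and $\delta'$ is a derivation on it, such that $\mathcal{K}'_{\delta'}$ is a model of the scheme (DL) and $\mathcal{K}'$ has the same $\mathcal{L}$-theory as $\mathcal{K}$. -/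

import Mathlib

open scoped FirstOrder Topology

universe u v w

/-- The `L`-structure `K` expands the field `K`: the symbols `+, *, -, 0, 1` of the language of
rings, viewed in `L` through `ι`, are interpreted by the field operations. -/
structure IsFieldExpansion {L : FirstOrder.Language.{u, v}} (ι : FirstOrder.Language.ring →ᴸ L)
    (K : Type w) [Field K] [L.Structure K] : Prop where
  add : ∀ x y : K, FirstOrder.Language.Structure.funMap (ι.onFunction FirstOrder.ringFunc.add) ![x, y] = x + y
  mul : ∀ x y : K, FirstOrder.Language.Structure.funMap (ι.onFunction FirstOrder.ringFunc.mul) ![x, y] = x * y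
  neg : ∀ x : K, FirstOrder.Language.Structure.funMap (ι.onFunction FirstOrder.ringFunc.neg) ![x] = -x
  zero : FirstOrder.Language.Structure.funMap (ι.onFunction FirstOrder.ringFunc.zero) ![] = (0 : K)
  one : FirstOrder.Language.Structure.funMap (ι.onFunction FirstOrder.ringFunc.one) ![] = (1 : K)

/-- The set `χ(K, a)` defined by the formula `χ(x, z)` at the parameters `z = a`. -/
def basicNhd {L : FirstOrder.Language.{u, v}} {k : ℕ} (χ : L.Formula (Fin 1 ⊕ Fin k))
    (K : Type w) [L.Structure K] (a : Fin k → K) : Set K :=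
  {x | χ.Realize (Sum.elim ![x] a)}

/-- The topology of `K` is definable through `χ`: the sets `χ(K, a)`, for `a` in `K`, form a
basis of neighbourhoods of `0`. -/
def IsNhdBasisFormula {L : FirstOrder.Language.{u, v}} {k : ℕ} (χ : L.Formula (Fin 1 ⊕ Fin k))
    (K : Type w) [Field K] [L.Structure K] [TopologicalSpace K] : Prop :=
  (𝓝 (0 : K)).HasBasis (fun _ : Fin k → K => True) (basicNhd χ K)

section Differential

/-- Differential polynomials in one differential indeterminate `x`; the variable `X i` stands
for `δ^i x`. -/
abbrev DiffPoly (K : Type w) [Field K] : Type w := MvPolynomial ℕ K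

namespace DiffPoly

variable {K : Type w} [Field K]

/-- `P` has order `m`: `δ^m x` occurs in `P`, and no `δ^i x` with `i > m` does. -/
def HasOrder (P : DiffPoly K) (m : ℕ) : Prop :=
  m ∈ P.vars ∧ ∀ i ∈ P.vars, i ≤ m

/-- The separant `∂P/∂(δ^m x)` of a differential polynomial of order `m`. -/
noncomputable def separant (m : ℕ) (P : DiffPoly K) : DiffPoly K :=
  MvPolynomial.pderiv m P

/-- The value `P(x)` in the differential field `(K, δ)`. -/
noncomputable def evalAt (δ : Derivation ℤ K K) (x : K) (P : DiffPoly K) : K :=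
  MvPolynomial.eval (fun i => δ^[i] x) P

/-- For `P` of order at most `m`, the ordinary polynomial `P^*` in the variables
`x_0, …, x_m` with `P(x) = P^*(x, δ x, …, δ^m x)`. -/
noncomputable def star (m : ℕ) (P : DiffPoly K) : MvPolynomial (Fin (m + 1)) K :=
  MvPolynomial.aeval
    (fun i => if h : i < m + 1 then MvPolynomial.X (⟨i, h⟩ : Fin (m + 1)) else 0) P

end DiffPoly

/-- The expansion `(K, δ)` of the `L`-structure `K` satisfies the axiom scheme (DL) with respect
to the formula `χ`: for every differential polynomial `P` of order `m`, all parameters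
`u_0, …, u_m` and every `y` with `P^*(y) = 0` and `s_P^*(y) ≠ 0`, there is `x` with `P(x) = 0`,
`s_P(x) ≠ 0` and `δ^i x - y_i ∈ χ(K, u_i)` for `i ≤ m`. -/
def ModelsDL {L : FirstOrder.Language.{u, v}} {k : ℕ} (χ : L.Formula (Fin 1 ⊕ Fin k))
    {K : Type w} [Field K] [L.Structure K] (δ : Derivation ℤ K K) : Prop :=
  ∀ (m : ℕ) (P : DiffPoly K), P.HasOrder m →
    ∀ (u : Fin (m + 1) → Fin k → K) (y : Fin (m + 1) → K),
      MvPolynomial.eval y (P.star m) = 0 →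
      MvPolynomial.eval y ((P.separant m).star m) ≠ 0 →
      ∃ x : K, P.evalAt δ x = 0 ∧ (P.separant m).evalAt δ x ≠ 0 ∧
        ∀ i : Fin (m + 1), δ^[i] x - y i ∈ basicNhd χ K (u i)

end Differential

section Large

/-- `K` is large: every irreducible plane curve over `K` with a smooth `K`-rational point has
infinitely many `K`-rational points. -/
def IsLargeField (K : Type w) [Field K] : Prop :=
  ∀ f : MvPolynomial (Fin 2) K, Irreducible f →
    (∃ a : Fin 2 → K, MvPolynomial.eval a f = 0 ∧
      ∃ i, MvPolynomial.eval a (MvPolynomial.pderiv i f) ≠ 0) →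
    {a : Fin 2 → K | MvPolynomial.eval a f = 0}.Infinite

/-- The ultrapower of `K` with respect to the ultrafilter `U`. -/
abbrev Ultrapower {I : Type w} (U : Ultrafilter I) (K : Type w) : Type w :=
  (U : Filter I).Product (fun _ => K)

/-- The field structure of an ultrapower, computed on representatives. -/
noncomputable instance Ultrapower.instField {I : Type w} (U : Ultrafilter I)
    (K : Type w) [Field K] : Field (Ultrapower U K) :=
  inferInstanceAs (Field (Filter.Germ (U : Filter I) K))

/-- The diagonal embedding of `K` into its ultrapower. -/
def Ultrapower.diag {I : Type w} (U : Ultrafilter I) (K : Type w) (a : K) : Ultrapower U K :=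
  Quotient.mk _ (fun _ => a)

/-- Let `N` be an extension of `K`, given with names for the elements of `K`. An element `x` of
`N` is `K`-infinitesimal, `x ∼_K 0`, if it satisfies every formula with parameters in `K` that
defines in `K` an open set containing `0`. -/
def IsInfinitesimal (L : FirstOrder.Language.{u, v}) (K : Type w) [Field K] [L.Structure K]
    [TopologicalSpace K] {N : Type w} [L[[K]].Structure N] (x : N) : Prop :=
  ∀ φ : L[[K]].Formula (Fin 1),
    IsOpen {a : K | φ.Realize ![a]} → φ.Realize ![(0 : K)] → φ.Realize ![x]

/-- `K` is c-large: it is large and, for every `n`, there is an embedding over `K` of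
`K((s_0, …, s_{n-1}))`, the fraction field of `K[[s_0, …, s_{n-1}]]`, into a nonprincipal
ultrapower of `K` that maps the maximal ideal of `K[[s_0, …, s_{n-1}]]` into the
`K`-infinitesimals. -/
def IsCLarge (L : FirstOrder.Language.{u, v}) (K : Type w) [Field K] [L.Structure K]
    [TopologicalSpace K] : Prop :=
  IsLargeField K ∧
    ∀ n : ℕ, ∃ (I : Type w) (U : Ultrafilter I), (∀ i : I, {i} ∉ U) ∧
      ∃ σ : FractionRing (MvPowerSeries (Fin n) K) →+* Ultrapower U K,
        (∀ a : K, σ (algebraMap (MvPowerSeries (Fin n) K) _ (MvPowerSeries.C a)) =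
          Ultrapower.diag U K a) ∧
        ∀ f ∈ IsLocalRing.maximalIdeal (MvPowerSeries (Fin n) K),
          IsInfinitesimal L K (σ (algebraMap (MvPowerSeries (Fin n) K) _ f))

end Large

/-!
Let `P^*(y) = 0` and `s_P^*(y) ≠ 0`, and let `s` be the variable of `K[[s]]`. Along the line
`y_i + (z_i - y_i) s`, `i < m`, from `y` to an arbitrary point `z`, Hensel's lemma in `K[[s]]`
solves `P^* = 0` for the last coordinate, infinitesimally close to `y_m`. As `s` is transcendental
over `K`, these first `m` coordinates avoid every hypersurface not containing `z`, so by Łoś's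
theorem the solutions of `P^* = 0` in `K` close to `y` have Zariski dense projections to the first
`m` coordinates. This density is inherited by ultrapowers, and it yields an ultrapower in which all
the systems over `K` are solved at once by tuples `a = (a_0, …, a_m)` whose first `m` coordinates
are jointly algebraically independent over `K`. Hence `δ` extends to this ultrapower with
`δ a_i = a_{i+1}`, which makes `a_0` a solution of the differential system. The union of the
elementary chain obtained by iterating this step is a model of (DL).
-/

open FirstOrder FirstOrder.Language

/-! ### Extension of derivations -/

section DerivationExtension

open KaehlerDifferential in
theorem exists_derivation_extension {A R S M : Type*} [CommRing A] [CommRing R] [CommRing S]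
    [Algebra A R] [Algebra A S] [Algebra R S] [IsScalarTower A R S] [Algebra.FormallySmooth R S]
    [AddCommGroup M] [Module A M] [Module R M] [Module S M] [IsScalarTower A S M]
    [IsScalarTower R S M] (d : Derivation A R M) :
    ∃ D : Derivation A S M, ∀ r, D (algebraMap R S r) = d r := by
  have hinj : Function.Injective (mapBaseChange A R S) := by
    rw [← LinearMap.ker_eq_bot, LinearMap.exact_iff.1
      (Algebra.H1Cotangent.exact_δ_mapBaseChange A R S), LinearMap.range_eq_bot]
    exact Subsingleton.elim _ _
  have hsection := Module.projective_lifting_property _ LinearMap.id (map_surjective A R S)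
  obtain ⟨-, l, hl⟩ :=
    ((exact_mapBaseChange_map A R S).split_tfae'.out 0 1 :).1 ⟨hinj, hsection⟩
  have : IsScalarTower A R M := .to₁₂₄ A R S M
  refine ⟨((d.liftKaehlerDifferential.liftBaseChange S) ∘ₗ l).compDer (D A S), fun r => ?_⟩
  have hr : l (D A S (algebraMap R S r)) = 1 ⊗ₜ D A R r := by
    simpa using LinearMap.congr_fun hl (1 ⊗ₜ D A R r)
  simp [hr]

theorem formallySmooth_of_charZero (R E : Type*) [CommRing R] [IsDomain R] [CharZero R] [Field E]
    [Algebra R E] [FaithfulSMul R E] : Algebra.FormallySmooth R E := by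
  let := FractionRing.liftAlgebra R E
  have : Algebra.FormallySmooth R (FractionRing R) := .of_isLocalization (nonZeroDivisors R)
  obtain ⟨s, hs⟩ := exists_isTranscendenceBasis (FractionRing R) E
  have := hs.isAlgebraic_field
  have : Algebra.FormallySmooth (FractionRing R) E :=
    .of_algebraicIndependent_of_isSeparable hs.1
  exact .comp R (FractionRing R) E

theorem exists_derivation_of_algebraicIndependent {F E ι : Type*} [Field F] [Field E]
    [Algebra F E] [CharZero F] {x : ι → E} (hx : AlgebraicIndependent F x) (t : ι → E)
    (δ : Derivation ℤ F F) :
    ∃ D : Derivation ℤ E E, (∀ a, D (algebraMap F E a) = algebraMap F E (δ a)) ∧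
      ∀ i, D (x i) = t i := by
  have := formallySmooth_of_charZero F E
  obtain ⟨D₀, hD₀⟩ := exists_derivation_extension (S := E) ((Algebra.linearMap F E).compDer δ)
  let := (MvPolynomial.aeval (R := F) x).toAlgebra
  have : IsScalarTower F (MvPolynomial ι F) E := .of_algHom (MvPolynomial.aeval x)
  have : FaithfulSMul (MvPolynomial ι F) E := (faithfulSMul_iff_algebraMap_injective _ _).2 hx
  have := formallySmooth_of_charZero (MvPolynomial ι F) E
  obtain ⟨D₁, hD₁⟩ := exists_derivation_extension (S := E)
    (MvPolynomial.mkDerivation F fun i => t i - D₀ (x i))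
  have hD₁x (i : ι) : D₁ (x i) = t i - D₀ (x i) := by
    simpa [RingHom.algebraMap_toAlgebra] using hD₁ (MvPolynomial.X i)
  exact ⟨D₀ + D₁.restrictScalars ℤ, fun a => by simp [hD₀], fun i => by simp [hD₁x]⟩

end DerivationExtension

/-! ### Hensel's lemma for arbitrary polynomials -/

section Henselian

open Polynomial

variable {R : Type*} [CommRing R] {I : Ideal R} [HenselianRing R I]

theorem isUnit_of_isUnit_mk {r : R}
    (hr : IsUnit (Ideal.Quotient.mk I r)) : IsUnit r :=
  have := isLocalHom_of_le_jacobson_bot I HenselianRing.jac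
  isUnit_of_map_unit _ _ hr

theorem exists_eq_one_add_mul_mul_eval {c : R} (hc : c ∈ I) (g : R[X]) :
    ∃ y, y = 1 + c * y * g.eval y := by
  nontriviality R
  obtain ⟨n, hn⟩ : ∃ n, g.natDegree = n := ⟨_, rfl⟩
  -- Unlike the equation for `y`, the one for `t = y⁻¹` is monic.
  let h : R[X] := X ^ (n + 1) + (C c * g.reverse - X ^ n)
  have hmonic : h.Monic := monic_X_pow_add <| degree_lt_iff_coeff_zero _ _ |>.2 fun m hm => by
    have hm' : g.reverse.natDegree < m := (hn ▸ g.reverse_natDegree_le).trans_lt hm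
    rw [coeff_sub, coeff_C_mul, coeff_eq_zero_of_natDegree_lt hm', coeff_X_pow,
      if_neg (Nat.lt_of_succ_le hm).ne', mul_zero, sub_zero]
  have hc' : Ideal.Quotient.mk I c = 0 := Ideal.Quotient.eq_zero_iff_mem.2 hc
  obtain ⟨t, ht, ht1⟩ := HenselianRing.is_henselian h hmonic 1
    (by simpa [h] using I.mul_mem_right _ hc) (by simp [h, hc', derivative_X_pow])
  have htu : IsUnit t := isUnit_of_isUnit_mk (I := I) (by simp [Ideal.Quotient.eq.2 ht1])
  let := htu.invertible
  have hrev : g.reverse.eval t * ⅟t ^ n = g.eval ⅟t := by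
    simpa [hn] using eval₂_reverse_mul_pow (RingHom.id R) (⅟t) g
  have h0 : t ^ (n + 1) + (c * g.reverse.eval t - t ^ n) = 0 := by simpa [h] using ht
  have hpow : t ^ n * ⅟t ^ n = 1 := by rw [← mul_pow, mul_invOf_self, one_pow]
  refine ⟨⅟t, ?_⟩
  linear_combination -(⅟t) ^ (n + 1) * h0 + c * ⅟t * hrev + (t * ⅟t - ⅟t) * hpow +
    mul_invOf_self t

theorem eval_add_eq (f : R[X]) (a x : R) : f.eval (a + x) =
    f.eval a + f.derivative.eval a * x + x ^ 2 * (taylor a f).divX.divX.eval x := by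
  have h₁ := congrArg (eval x) (divX_mul_X_add (taylor a f).divX)
  have h₀ := congrArg (eval x) (divX_mul_X_add (taylor a f))
  simp only [eval_add, eval_mul, eval_X, eval_C, coeff_divX, taylor_eval, taylor_coeff_zero,
    taylor_coeff_one, zero_add] at h₀ h₁
  rw [add_comm a x]
  linear_combination -h₀ - x * h₁

theorem exists_isRoot_of_isUnit_mk_derivative (f : R[X]) (a : R) (ha : f.eval a ∈ I)
    (ha' : IsUnit (Ideal.Quotient.mk I (f.derivative.eval a))) :
    ∃ b, f.IsRoot b ∧ b - a ∈ I := by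
  obtain ⟨v, hv⟩ := (isUnit_of_isUnit_mk ha').exists_right_inv
  set g := (taylor a f).divX.divX
  obtain ⟨y, hy⟩ := exists_eq_one_add_mul_mul_eval (I.mul_mem_right (v ^ 2) ha)
    (X * g.comp (C (-(f.eval a * v)) * X))
  refine ⟨a + -(f.eval a * v) * y, ?_, ?_⟩
  · rw [IsRoot, eval_add_eq]
    simp only [eval_mul, eval_X, eval_comp, eval_C] at hy
    linear_combination -f.eval a * hy - f.eval a * y * hv
  · rw [add_sub_cancel_left, ← mul_neg, mul_assoc]
    exact I.mul_mem_right _ ha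

end Henselian

/-! ### Zariski density -/

section ZariskiDense

/-- A set of points of affine space is Zariski dense if no nonzero polynomial vanishes on it. -/
def IsZariskiDense {F σ : Type*} [CommSemiring F] (S : Set (σ → F)) : Prop :=
  ∀ q : MvPolynomial σ F, q ≠ 0 → ∃ a ∈ S, MvPolynomial.eval a q ≠ 0

namespace IsZariskiDense

variable {F J : Type*} {V : J → Type*}

theorem nonempty {σ : Type*} [CommSemiring F] [Nontrivial F] {S : Set (σ → F)}
    (hS : IsZariskiDense S) : S.Nonempty :=
  let ⟨a, ha, _⟩ := hS 1 one_ne_zero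
  ⟨a, ha⟩

theorem univ {σ : Type*} [CommRing F] [IsDomain F] [Infinite F] :
    IsZariskiDense (Set.univ : Set (σ → F)) := fun q hq => by
  by_contra! h
  exact hq (MvPolynomial.funext fun z => by rw [h z trivial, map_zero])

theorem exists_eval_update_ne_zero [CommSemiring F] [DecidableEq J] {j : J} {S : Set (V j → F)}
    (hS : IsZariskiDense S) {q : MvPolynomial (Σ j, V j) F} {b : ∀ j, V j → F}
    (hb : MvPolynomial.eval (fun p => b p.1 p.2) q ≠ 0) :
    ∃ s ∈ S, MvPolynomial.eval (fun p => Function.update b j s p.1 p.2) q ≠ 0 := by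
  let q' : MvPolynomial (V j) F := MvPolynomial.aeval (fun p : Σ j, V j =>
    Function.update (fun i v => MvPolynomial.C (b i v)) j MvPolynomial.X p.1 p.2) q
  have hq' (s : V j → F) : MvPolynomial.eval s q' =
      MvPolynomial.eval (fun p => Function.update b j s p.1 p.2) q := by
    rw [← MvPolynomial.aeval_eq_eval, ← AlgHom.comp_apply, MvPolynomial.comp_aeval,
      ← MvPolynomial.aeval_eq_eval]
    congr 2
    funext ⟨i, v⟩
    obtain rfl | h := eq_or_ne i j
    · simp
    · simp [Function.update_of_ne h]
  obtain ⟨s, hs, hsq⟩ := hS q' fun h0 => hb <| by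
    rw [← Function.update_eq_self j b, ← hq', h0, map_zero]
  exact ⟨s, hs, hq' s ▸ hsq⟩

theorem sigma [CommRing F] [IsDomain F] [Infinite F] {S : ∀ j, Set (V j → F)}
    (hS : ∀ j, IsZariskiDense (S j)) :
    IsZariskiDense {a : (Σ j, V j) → F | ∀ j, (fun v => a ⟨j, v⟩) ∈ S j} := by
  classical
  intro q hq
  have hfinite (T : Finset J) : ∃ a : ∀ j, V j → F, (∀ j ∈ T, a j ∈ S j) ∧
      MvPolynomial.eval (fun p => a p.1 p.2) q ≠ 0 := by
    induction T using Finset.induction_on with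
    | empty =>
      obtain ⟨z, -, hz⟩ := IsZariskiDense.univ q hq
      exact ⟨fun j v => z ⟨j, v⟩, by simp, hz⟩
    | insert j T hj ih =>
      obtain ⟨b, hbT, hb⟩ := ih
      obtain ⟨s, hs, hsq⟩ := (hS j).exists_eval_update_ne_zero hb
      refine ⟨Function.update b j s, fun i hi => ?_, hsq⟩
      obtain rfl | h := eq_or_ne i j
      · simpa only [Function.update_self] using hs
      · simpa only [Function.update_of_ne h] using hbT i (Finset.mem_of_mem_insert_of_ne hi h)
  choose c hc using fun j => (hS j).nonempty
  let T := q.vars.image Sigma.fst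
  obtain ⟨a, haT, ha⟩ := hfinite T
  refine ⟨fun p => if p.1 ∈ T then a p.1 p.2 else c p.1 p.2, fun j => ?_, ?_⟩
  · change (fun v => if j ∈ T then a j v else c j v) ∈ S j
    split_ifs with h
    exacts [haT j h, hc j]
  · convert ha using 1
    refine MvPolynomial.eval₂Hom_congr' rfl (fun p hp _ => ?_) rfl
    exact if_pos (Finset.mem_image_of_mem Sigma.fst hp)

end IsZariskiDense

end ZariskiDense

theorem exists_ultrafilter_forall_eventually_dvd (R : Type*) [CommMonoidWithZero R]
    [NoZeroDivisors R] [Nontrivial R] :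
    ∃ U : Ultrafilter {q : R // q ≠ 0},
      ∀ q : R, q ≠ 0 → ∀ᶠ p : {q : R // q ≠ 0} in U, q ∣ p.1 := by
  let multiples (q : {q : R // q ≠ 0}) : Filter {q : R // q ≠ 0} :=
    Filter.principal {p | q.1 ∣ p.1}
  have : Nonempty {q : R // q ≠ 0} := ⟨⟨1, one_ne_zero⟩⟩
  have : (⨅ q, multiples q).NeBot := by
    refine Filter.iInf_neBot_of_directed' (fun q r => ⟨⟨q.1 * r.1, mul_ne_zero q.2 r.2⟩, ?_, ?_⟩)
      fun q => Filter.principal_neBot_iff.2 ⟨q, dvd_rfl⟩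
    · exact Filter.principal_mono.2 fun p hp => (dvd_mul_right _ _).trans hp
    · exact Filter.principal_mono.2 fun p hp => (dvd_mul_left _ _).trans hp
  refine ⟨Ultrafilter.of (⨅ q, multiples q), fun q hq => ?_⟩
  exact Ultrafilter.of_le _ (Filter.mem_iInf_of_mem ⟨q, hq⟩ (Filter.mem_principal_self _))

section LastVariable

open Polynomial in
/-- The polynomial in one variable obtained from `f` by substituting `a` for all variables but the
last. -/
noncomputable def specializeInit {R S : Type*} [CommSemiring R] [CommSemiring S] [Algebra R S]
    {m : ℕ} (a : Fin m → S) : MvPolynomial (Fin (m + 1)) R →ₐ[R] S[X] :=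
  MvPolynomial.aeval (Fin.snoc (fun i => Polynomial.C (a i)) Polynomial.X)

variable {R S : Type*} [CommSemiring R] [CommSemiring S] [Algebra R S] {m : ℕ} (a : Fin m → S)
  (f : MvPolynomial (Fin (m + 1)) R)

theorem eval_specializeInit (r : S) :
    (specializeInit a f).eval r = MvPolynomial.aeval (Fin.snoc a r : Fin (m + 1) → S) f := by
  induction f using MvPolynomial.induction_on with
  | C c => simp [specializeInit, Polynomial.algebraMap_apply]
  | add f g hf hg => rw [map_add, Polynomial.eval_add, hf, hg, map_add]
  | mul_X f i hf =>
    rw [map_mul, Polynomial.eval_mul, hf, map_mul]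
    refine congrArg _ ?_
    cases i using Fin.lastCases <;> simp [specializeInit]

theorem derivative_specializeInit :
    (specializeInit a f).derivative = specializeInit a (MvPolynomial.pderiv (Fin.last m) f) := by
  induction f using MvPolynomial.induction_on with
  | C c => simp [specializeInit, Polynomial.algebraMap_apply]
  | add f g hf hg => simp only [map_add, hf, hg]
  | mul_X f i hf =>
    have hX : (specializeInit a (MvPolynomial.X (R := R) i)).derivative =
        specializeInit a (MvPolynomial.pderiv (R := R) (Fin.last m) (MvPolynomial.X i)) := by
      cases i using Fin.lastCases with
      | last => simp [specializeInit]
      | cast i =>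
        rw [MvPolynomial.pderiv_X_of_ne (Fin.castSucc_lt_last i).ne]
        simp [specializeInit]
    simp only [map_mul, Polynomial.derivative_mul, hf, hX, Derivation.leibniz, smul_eq_mul,
      map_add, mul_comm, add_comm]

end LastVariable

/-! ### Instances of (DL) -/

section Systems

variable {R S : Type*} [CommSemiring R] [CommSemiring S] {k m : ℕ}

/-- `a` is a zero of `f` at which the derivative of `f` in the last variable does not vanish. -/
def IsRegularZero (f : MvPolynomial (Fin (m + 1)) R) (a : Fin (m + 1) → R) : Prop :=
  MvPolynomial.eval a f = 0 ∧ MvPolynomial.eval a (MvPolynomial.pderiv (Fin.last m) f) ≠ 0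

theorem eval_comp_map {σ : Type*} (φ : R →+* S) (a : σ → R) (f : MvPolynomial σ R) :
    MvPolynomial.eval (φ ∘ a) (MvPolynomial.map φ f) = φ (MvPolynomial.eval a f) := by
  rw [MvPolynomial.eval_map, MvPolynomial.eval₂_comp]

theorem isRegularZero_map_iff {φ : R →+* S} (hφ : Function.Injective φ)
    {f : MvPolynomial (Fin (m + 1)) R} {a : Fin (m + 1) → R} :
    IsRegularZero (MvPolynomial.map φ f) (φ ∘ a) ↔ IsRegularZero f a := by
  simp only [IsRegularZero, MvPolynomial.pderiv_map, eval_comp_map, ne_eq,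
    map_eq_zero_iff φ hφ]

/-- An instance of the scheme (DL) of order `m`: the polynomial `P^*`, the point `y` and the
parameters `u_0, …, u_m` of the neighbourhoods. The condition on `y` is
`DLSystem.IsRegular`. -/
structure DLSystem (R : Type*) [CommSemiring R] (k m : ℕ) where
  poly : MvPolynomial (Fin (m + 1)) R
  center : Fin (m + 1) → R
  radius : Fin (m + 1) → Fin k → R

namespace DLSystem

/-- The system obtained by applying a ring homomorphism to all coefficients. -/
noncomputable def map (φ : R →+* S) (s : DLSystem R k m) : DLSystem S k m where
  poly := MvPolynomial.map φ s.poly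
  center := φ ∘ s.center
  radius i := φ ∘ s.radius i

theorem map_id (s : DLSystem R k m) : s.map (RingHom.id R) = s :=
  congrArg (mk · s.center s.radius) (MvPolynomial.map_id s.poly)

theorem map_map {T : Type*} [CommSemiring T] (φ : R →+* S) (ψ : S →+* T) (s : DLSystem R k m) :
    (s.map φ).map ψ = s.map (ψ.comp φ) :=
  congrArg (mk · _ _) (MvPolynomial.map_map φ ψ s.poly)

theorem map_surjective {φ : R →+* S} (hφ : Function.Surjective φ) :
    Function.Surjective (map φ : DLSystem R k m → DLSystem S k m) := fun ⟨f, y, r⟩ => by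
  obtain ⟨f, rfl⟩ := MvPolynomial.map_surjective φ hφ f
  obtain ⟨y, rfl⟩ := hφ.comp_left y
  choose r' hr' using fun i => hφ.comp_left (r i)
  obtain rfl : (fun i => φ ∘ r' i) = r := funext hr'
  exact ⟨⟨f, y, r'⟩, rfl⟩

/-- The condition `P^*(y) = 0` and `s_P^*(y) ≠ 0` on an instance of (DL). -/
def IsRegular (s : DLSystem R k m) : Prop := IsRegularZero s.poly s.center

variable {L : FirstOrder.Language.{u, v}} {F : Type w} [Field F] [L.Structure F]

/-- The regular zeros `a` of `P^*` with `a_i - y_i ∈ χ(F, u_i)` for all `i`. A solution of the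
corresponding differential system is an `x` whose jet `(x, δ x, …, δ^m x)` is such a zero. -/
def solutions (χ : L.Formula (Fin 1 ⊕ Fin k)) (s : DLSystem F k m) :
    Set (Fin (m + 1) → F) :=
  {a | IsRegularZero s.poly a ∧ ∀ i, a i - s.center i ∈ basicNhd χ F (s.radius i)}

theorem mem_solutions_map_iff {χ : L.Formula (Fin 1 ⊕ Fin k)} {φ : R →+* F}
    {s : DLSystem R k m} {a : Fin (m + 1) → F} :
    a ∈ (s.map φ).solutions χ ↔ IsRegularZero (MvPolynomial.map φ s.poly) a ∧
      ∀ i, a i - φ (s.center i) ∈ basicNhd χ F (φ ∘ s.radius i) := Iff.rfl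

end DLSystem

end Systems

section Tuples

variable {M N : Type*} (g : M → N)

theorem comp_vecSingle (x : M) : g ∘ ![x] = ![g x] := by
  ext i; fin_cases i; rfl

theorem comp_vecPair (x y : M) : g ∘ ![x, y] = ![g x, g y] := by
  ext i; fin_cases i <;> rfl

end Tuples

theorem mem_basicNhd_comp_iff {L : FirstOrder.Language.{u, v}} {k : ℕ}
    (χ : L.Formula (Fin 1 ⊕ Fin k)) {X M : Type*} [L.Structure M] (g : X → M)
    (x : X) (a : Fin k → X) :
    g x ∈ basicNhd χ M (g ∘ a) ↔ χ.Realize (g ∘ Sum.elim ![x] a) := by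
  rw [Sum.comp_elim, comp_vecSingle]
  rfl

/-! ### Ultrapowers -/

theorem eval_map_evalRingHom {I F τ : Type*} [CommSemiring F] (f : MvPolynomial τ (I → F))
    (a : τ → I → F) (i : I) :
    MvPolynomial.eval (Function.eval i ∘ a) (MvPolynomial.map (Pi.evalRingHom (fun _ => F) i) f) =
      MvPolynomial.eval a f i :=
  eval_comp_map (Pi.evalRingHom (fun _ => F) i) a f

namespace Ultrapower

variable {I : Type w} (U : Ultrafilter I) (F : Type w) [Field F]

/-- The map sending a family of elements to its class in the ultrapower. -/
noncomputable def mkHom : (I → F) →+* Ultrapower U F :=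
  (Filter.Germ.coeRingHom (U : Filter I) : (I → F) →+* Filter.Germ (U : Filter I) F)

theorem mkHom_surjective : Function.Surjective (mkHom U F) := Quotient.mk_surjective

noncomputable instance : Algebra F (Ultrapower U F) :=
  ((mkHom U F).comp (Pi.constRingHom I F)).toAlgebra

variable {U F}

theorem mkHom_eq_zero_iff {a : I → F} : mkHom U F a = 0 ↔ ∀ᶠ i in U, a i = 0 :=
  Filter.Germ.coe_eq

theorem mkHom_comp_const_comp {τ : Type*} (a : τ → F) :
    mkHom U F ∘ (fun t _ => a t) = algebraMap F (Ultrapower U F) ∘ a := rfl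

theorem aeval_mkHom_comp {τ : Type*} (q : MvPolynomial τ F) (a : τ → I → F) :
    MvPolynomial.aeval (mkHom U F ∘ a) q =
      mkHom U F fun i => MvPolynomial.eval (Function.eval i ∘ a) q := by
  rw [MvPolynomial.aeval_def, ← MvPolynomial.eval_map]
  change MvPolynomial.eval _ (MvPolynomial.map ((mkHom U F).comp (Pi.constRingHom I F)) q) = _
  rw [← MvPolynomial.map_map, eval_comp_map]
  refine congrArg _ (funext fun i => ?_)
  rw [← eval_map_evalRingHom, MvPolynomial.map_map]
  exact congrArg _ (MvPolynomial.map_id q)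

variable {L : FirstOrder.Language.{u, v}} [L.Structure F]

theorem realize_mkHom_comp {β : Type*} (φ : L.Formula β) (x : β → I → F) :
    φ.Realize (mkHom U F ∘ x) ↔ ∀ᶠ i in U, φ.Realize (Function.eval i ∘ x) :=
  Ultraproduct.realize_formula_cast (M := fun _ => F) (u := U) φ x

theorem realize_withConstants_mkHom_comp {β : Type*} (φ : L[[F]].Formula β) (x : β → I → F) :
    φ.Realize (mkHom U F ∘ x) ↔ ∀ᶠ i in U, φ.Realize (Function.eval i ∘ x) := by
  have hstructure : (Ultraproduct.structure : L[[F]].Structure (Ultrapower U F)) =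
      L.withConstantsStructure F := by
    refine Structure.ext ?_ ?_ <;> funext n f x <;> rcases f with f | f <;> rfl
  rw [← hstructure]
  exact Ultraproduct.realize_formula_cast (M := fun _ => F) (u := U) φ x

theorem mem_basicNhd_mkHom {k : ℕ} (χ : L.Formula (Fin 1 ⊕ Fin k)) (x : I → F)
    (a : Fin k → I → F) : mkHom U F x ∈ basicNhd χ (Ultrapower U F) (mkHom U F ∘ a) ↔
      ∀ᶠ i in U, x i ∈ basicNhd χ F (Function.eval i ∘ a) := by
  rw [mem_basicNhd_comp_iff, realize_mkHom_comp]
  simp only [← mem_basicNhd_comp_iff, Function.eval]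

theorem funMap_mkHom_comp {n : ℕ} (f : L.Functions n) (x : Fin n → I → F) :
    Structure.funMap f (mkHom U F ∘ x) =
      mkHom U F (fun i => Structure.funMap f (Function.eval i ∘ x)) :=
  Ultraproduct.funMap_cast (M := fun _ => F) (u := U) f x

theorem isFieldExpansion {ι : FirstOrder.Language.ring →ᴸ L} (hF : IsFieldExpansion ι F) :
    IsFieldExpansion ι (Ultrapower U F) where
  add x y := by
    obtain ⟨a, rfl⟩ := mkHom_surjective U F x
    obtain ⟨b, rfl⟩ := mkHom_surjective U F y
    simp only [← comp_vecPair, funMap_mkHom_comp]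
    simp only [comp_vecPair, hF.add, ← map_add]
    rfl
  mul x y := by
    obtain ⟨a, rfl⟩ := mkHom_surjective U F x
    obtain ⟨b, rfl⟩ := mkHom_surjective U F y
    simp only [← comp_vecPair, funMap_mkHom_comp]
    simp only [comp_vecPair, hF.mul, ← map_mul]
    rfl
  neg x := by
    obtain ⟨a, rfl⟩ := mkHom_surjective U F x
    simp only [← comp_vecSingle, funMap_mkHom_comp]
    simp only [comp_vecSingle, hF.neg, ← map_neg]
    rfl
  zero := by
    rw [Subsingleton.elim ![] (mkHom U F ∘ ![]), funMap_mkHom_comp, ← map_zero (mkHom U F)]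
    exact congrArg _ (funext fun i => (congrArg _ (Subsingleton.elim _ _)).trans hF.zero)
  one := by
    rw [Subsingleton.elim ![] (mkHom U F ∘ ![]), funMap_mkHom_comp, ← map_one (mkHom U F)]
    exact congrArg _ (funext fun i => (congrArg _ (Subsingleton.elim _ _)).trans hF.one)

variable (U F L) in
/-- The diagonal embedding of a structure into its ultrapower. -/
noncomputable def diagElementary : F ↪ₑ[L] Ultrapower U F where
  toFun := algebraMap F (Ultrapower U F)
  map_formula' _ φ x :=
    (realize_mkHom_comp (U := U) φ fun b _ => x b).trans <|
      Filter.eventually_const (p := φ.Realize x)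

section Systems

variable {k m : ℕ} (χ : L.Formula (Fin 1 ⊕ Fin k))

theorem isRegularZero_mkHom_iff (f : MvPolynomial (Fin (m + 1)) (I → F))
    (a : Fin (m + 1) → I → F) : IsRegularZero (MvPolynomial.map (mkHom U F) f) (mkHom U F ∘ a) ↔
      ∀ᶠ i in U, IsRegularZero (MvPolynomial.map (Pi.evalRingHom _ i) f) (Function.eval i ∘ a) := by
  simp only [IsRegularZero, MvPolynomial.pderiv_map, eval_comp_map, eval_map_evalRingHom,
    ne_eq, mkHom_eq_zero_iff, Filter.eventually_and, Ultrafilter.eventually_not]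

theorem mem_solutions_mkHom_iff (s : DLSystem (I → F) k m) (a : Fin (m + 1) → I → F) :
    mkHom U F ∘ a ∈ (s.map (mkHom U F)).solutions χ ↔
      ∀ᶠ i in U, Function.eval i ∘ a ∈ (s.map (Pi.evalRingHom _ i)).solutions χ := by
  simp only [DLSystem.mem_solutions_map_iff, Function.comp_apply, ← map_sub, mem_basicNhd_mkHom,
    isRegularZero_mkHom_iff, Filter.eventually_and, Filter.eventually_all]
  rfl

theorem mem_solutions_diag_iff (s : DLSystem F k m) (a : Fin (m + 1) → I → F) :
    mkHom U F ∘ a ∈ (s.map (algebraMap F (Ultrapower U F))).solutions χ ↔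
      ∀ᶠ i in U, Function.eval i ∘ a ∈ s.solutions χ := by
  have hs : s.map (algebraMap F (Ultrapower U F)) =
    (s.map (Pi.constRingHom I F)).map (mkHom U F) := by
    rw [DLSystem.map_map]
    rfl
  have hs' (i : I) : (s.map (Pi.constRingHom I F)).map (Pi.evalRingHom _ i) = s := by
    rw [DLSystem.map_map]
    exact s.map_id
  rw [hs, mem_solutions_mkHom_iff]
  simp only [hs']

end Systems

end Ultrapower

/-- For every instance of (DL), the first `m` coordinates of its solutions are Zariski dense. -/
def HasDenseZeros {L : FirstOrder.Language.{u, v}} {k : ℕ} (χ : L.Formula (Fin 1 ⊕ Fin k))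
    (F : Type w) [Field F] [L.Structure F] : Prop :=
  ∀ (m : ℕ) (s : DLSystem F k m), s.IsRegular →
    IsZariskiDense ((fun a => a ∘ Fin.castSucc) '' s.solutions χ)

open Ultrapower in
theorem HasDenseZeros.ultrapower {L : FirstOrder.Language.{u, v}} {k : ℕ}
    {χ : L.Formula (Fin 1 ⊕ Fin k)} {F : Type w} [Field F] [L.Structure F]
    (h : HasDenseZeros χ F) {I : Type w} (U : Ultrafilter I) :
    HasDenseZeros χ (Ultrapower U F) := by
  intro m s hs q hq
  obtain ⟨s, rfl⟩ := DLSystem.map_surjective (mkHom_surjective U F) s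
  obtain ⟨q, rfl⟩ := MvPolynomial.map_surjective _ (mkHom_surjective U F) q
  have hq : ∀ᶠ i in U, MvPolynomial.map (Pi.evalRingHom (fun _ => F) i) q ≠ 0 := by
    obtain ⟨d, hd⟩ := MvPolynomial.ne_zero_iff.1 hq
    rw [MvPolynomial.coeff_map, ne_eq, mkHom_eq_zero_iff, ← Ultrafilter.eventually_not] at hd
    filter_upwards [hd] with i hi
    exact MvPolynomial.ne_zero_iff.2 ⟨d, by rwa [MvPolynomial.coeff_map]⟩
  have hsol : ∀ᶠ i in U, ∃ a ∈ (s.map (Pi.evalRingHom (fun _ => F) i)).solutions χ,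
      MvPolynomial.eval (a ∘ Fin.castSucc)
        (MvPolynomial.map (Pi.evalRingHom (fun _ => F) i) q) ≠ 0 := by
    filter_upwards [(isRegularZero_mkHom_iff s.poly s.center).1 hs, hq] with i hsi hqi
    obtain ⟨_, ⟨a, ha, rfl⟩, haq⟩ := h m (s.map (Pi.evalRingHom (fun _ => F) i)) hsi _ hqi
    exact ⟨a, ha, haq⟩
  obtain ⟨a, ha⟩ := hsol.choice
  refine ⟨_, ⟨mkHom U F ∘ fun j i => a i j, ?_, rfl⟩, ?_⟩
  · rw [mem_solutions_mkHom_iff]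
    exact ha.mono fun _ hi => hi.1
  · beta_reduce
    rw [Function.comp_assoc, eval_comp_map, ne_eq, mkHom_eq_zero_iff, ← Ultrafilter.eventually_not]
    refine ha.mono fun i hi => ?_
    rw [← eval_map_evalRingHom]
    exact hi.2

/-! ### Solutions close to a regular zero -/

section ImplicitFunction

variable {K R : Type*} [CommRing R] {J : Ideal R}

theorem aeval_sub_aeval_mem [CommRing K] [Algebra K R] {σ : Type*} {b c : σ → R}
    (h : ∀ i, b i - c i ∈ J) (f : MvPolynomial σ K) :
    MvPolynomial.aeval b f - MvPolynomial.aeval c f ∈ J := by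
  have hbc : Ideal.Quotient.mkₐ K J ∘ b = Ideal.Quotient.mkₐ K J ∘ c :=
    funext fun i => Ideal.Quotient.eq.2 (h i)
  refine Ideal.Quotient.eq.1 ?_
  change Ideal.Quotient.mkₐ K J _ = Ideal.Quotient.mkₐ K J _
  rw [MvPolynomial.comp_aeval_apply, MvPolynomial.comp_aeval_apply]
  exact congrArg (MvPolynomial.aeval · f) hbc

theorem exists_zero_of_isRegularZero [Field K] [Algebra K R] [HenselianRing R J] {m : ℕ}
    {f : MvPolynomial (Fin (m + 1)) K} {y : Fin (m + 1) → K} (hy : IsRegularZero f y)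
    {a : Fin m → R} (ha : ∀ i, a i - algebraMap K R (y i.castSucc) ∈ J) :
    ∃ b : Fin (m + 1) → R, b ∘ Fin.castSucc = a ∧ (∀ i, b i - algebraMap K R (y i) ∈ J) ∧
      MvPolynomial.aeval b f = 0 ∧
      IsUnit (MvPolynomial.aeval b (MvPolynomial.pderiv (Fin.last m) f)) := by
  have hsnoc {r : R} (hr : r - algebraMap K R (y (Fin.last m)) ∈ J) (i : Fin (m + 1)) :
      (Fin.snoc a r : Fin (m + 1) → R) i - algebraMap K R (y i) ∈ J := by
    cases i using Fin.lastCases with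
    | last => simpa using hr
    | cast i => simpa using ha i
  have haeval (g : MvPolynomial (Fin (m + 1)) K) {r : R}
      (hr : r - algebraMap K R (y (Fin.last m)) ∈ J) :
      (specializeInit a g).eval r - algebraMap K R (MvPolynomial.eval y g) ∈ J := by
    rw [eval_specializeInit, ← MvPolynomial.aeval_eq_eval, ← MvPolynomial.aeval_algebraMap_apply]
    exact aeval_sub_aeval_mem (hsnoc hr) g
  have hunit {r : R} (hr : r - algebraMap K R (y (Fin.last m)) ∈ J) :
      IsUnit (Ideal.Quotient.mk J ((specializeInit a f).derivative.eval r)) := by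
    rw [derivative_specializeInit, Ideal.Quotient.eq.2 (haeval _ hr)]
    exact ((isUnit_iff_ne_zero.2 hy.2).map (algebraMap K R)).map _
  have hy0 : algebraMap K R (y (Fin.last m)) - algebraMap K R (y (Fin.last m)) ∈ J := by simp
  obtain ⟨r, hr, hrJ⟩ := exists_isRoot_of_isUnit_mk_derivative (I := J) (specializeInit a f)
    (algebraMap K R (y (Fin.last m))) (by simpa [hy.1] using haeval f hy0) (hunit hy0)
  refine ⟨Fin.snoc a r, Fin.snoc_comp_castSucc, hsnoc hrJ, ?_, ?_⟩
  · rw [← eval_specializeInit]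
    exact hr
  · rw [← eval_specializeInit, ← derivative_specializeInit]
    exact isUnit_of_isUnit_mk (hunit hrJ)

theorem aeval_line_ne_zero {A σ : Type*} [CommRing K] [CommRing A] [Algebra K A] {t : A}
    (ht : Transcendental K t) {q : MvPolynomial σ K} {y z : σ → K}
    (hz : MvPolynomial.eval z q ≠ 0) :
    MvPolynomial.aeval (fun i => algebraMap K A (y i) + algebraMap K A (z i - y i) * t) q ≠ 0 := by
  let p : Polynomial K := MvPolynomial.aeval
    (fun i => Polynomial.C (y i) + Polynomial.C (z i - y i) * Polynomial.X) q
  have hpt : Polynomial.aeval t p = MvPolynomial.aeval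
      (fun i => algebraMap K A (y i) + algebraMap K A (z i - y i) * t) q := by
    simp only [p, MvPolynomial.comp_aeval_apply, map_add, map_mul, Polynomial.aeval_C,
      Polynomial.aeval_X]
  have hp1 : Polynomial.aeval 1 p = MvPolynomial.eval z q := by
    simp [p, MvPolynomial.comp_aeval_apply]
  rw [← hpt]
  intro h0
  rw [transcendental_iff.1 ht p h0, map_zero] at hp1
  exact hz hp1.symm

end ImplicitFunction

section Infinitesimal

variable {L : FirstOrder.Language.{u, v}} (ι : FirstOrder.Language.ring →ᴸ L) {k : ℕ}
  (χ : L.Formula (Fin 1 ⊕ Fin k)) {K : Type w}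

/-- The formula `∃ v, ∀ z, χ(z, v) → χ(x + z, u)` with parameters `u`, which defines the interior
of `χ(K, u)`. -/
noncomputable def interiorFormula (u : Fin k → K) : L[[K]].Formula (Fin 1) :=
  let χ' : L[[K]].Formula (Fin 1 ⊕ Fin k) := (L.lhomWithConstants K).onFormula χ
  let add : L[[K]].Functions 2 := (L.lhomWithConstants K).onFunction (ι.onFunction ringFunc.add)
  Formula.iExs (Fin k) (Formula.iAlls (Fin 1)
    ((χ'.relabel (Sum.elim (fun _ => Sum.inr 0) (fun t => Sum.inl (Sum.inr t)))).imp
      (BoundedFormula.subst χ' (Sum.elim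
        (fun _ => add.apply₂ (Term.var (Sum.inl (Sum.inl 0))) (Term.var (Sum.inr 0)))
        (fun t => (L.con (u t)).term)) : L[[K]].Formula ((Fin 1 ⊕ Fin k) ⊕ Fin 1))))

variable [Field K] [L.Structure K]

theorem realize_interiorFormula (hK : IsFieldExpansion ι K) (x : K) (u : Fin k → K) :
    (interiorFormula ι χ u).Realize ![x] ↔
      ∃ v : Fin k → K, ∀ z ∈ basicNhd χ K v, x + z ∈ basicNhd χ K u := by
  simp only [interiorFormula, Formula.realize_iExs, Formula.realize_iAlls, Formula.realize_imp,
    Formula.realize_relabel, LHom.realize_onFormula]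
  refine exists_congr fun v => (Equiv.funUnique (Fin 1) K).forall_congr fun z => imp_congr ?_ ?_
  · refine iff_of_eq (congrArg χ.Realize (funext ?_))
    rintro (b | b)
    · rw [Subsingleton.elim b 0]; rfl
    · rfl
  · rw [Formula.Realize, BoundedFormula.realize_subst, ← Formula.Realize, LHom.realize_onFormula]
    refine iff_of_eq (congrArg χ.Realize (funext ?_))
    rintro (b | b)
    · rw [Subsingleton.elim b 0]
      exact (Term.realize_functions_apply₂).trans (hK.add _ _)
    · exact Term.realize_constants

variable [TopologicalSpace K]

theorem mem_interior_basicNhd_iff [IsTopologicalAddGroup K] (hχ : IsNhdBasisFormula χ K) (x : K)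
    (u : Fin k → K) : x ∈ interior (basicNhd χ K u) ↔
      ∃ v : Fin k → K, ∀ z ∈ basicNhd χ K v, x + z ∈ basicNhd χ K u := by
  rw [mem_interior_iff_mem_nhds, ← map_add_left_nhds_zero, Filter.mem_map, hχ.mem_iff]
  simp only [true_and, Set.subset_def, Set.mem_preimage]

variable {ι χ}

theorem IsInfinitesimal.mem_basicNhd [IsTopologicalAddGroup K] (hK : IsFieldExpansion ι K)
    (hχ : IsNhdBasisFormula χ K) {I : Type w} {U : Ultrafilter I} {x : Ultrapower U K}
    (hx : IsInfinitesimal L K x) (u : Fin k → K) :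
    x ∈ basicNhd χ (Ultrapower U K) (algebraMap K (Ultrapower U K) ∘ u) := by
  obtain ⟨x, rfl⟩ := Ultrapower.mkHom_surjective U K x
  have hφ (a : K) : (interiorFormula ι χ u).Realize ![a] ↔ a ∈ interior (basicNhd χ K u) := by
    rw [realize_interiorFormula ι χ hK, mem_interior_basicNhd_iff χ hχ]
  have hx' := hx (interiorFormula ι χ u) (by simp only [hφ]; exact isOpen_interior)
    ((hφ 0).2 (mem_interior_iff_mem_nhds.2 (hχ.mem_of_mem trivial)))
  rw [← comp_vecSingle, Ultrapower.realize_withConstants_mkHom_comp] at hx'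
  rw [← Ultrapower.mkHom_comp_const_comp, Ultrapower.mem_basicNhd_mkHom]
  filter_upwards [hx'] with i hi
  rw [comp_vecSingle] at hi
  exact interior_subset ((hφ (x i)).1 hi)

theorem hasDenseZeros_of_henselianRing [Infinite K] [IsTopologicalAddGroup K]
    (hK : IsFieldExpansion ι K)
    (hχ : IsNhdBasisFormula χ K) {I : Type w} {U : Ultrafilter I} {R : Type*} [CommRing R]
    [Algebra K R] {J : Ideal R} [HenselianRing R J] (τ : R →ₐ[K] Ultrapower U K)
    (hτ : ∀ a ∈ J, IsInfinitesimal L K (τ a)) {t : R} (htJ : t ∈ J)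
    (ht : Transcendental K (τ t)) : HasDenseZeros χ K := by
  intro m s hs q hq
  obtain ⟨z, -, hz⟩ := IsZariskiDense.univ q hq
  let y : Fin m → K := s.center ∘ Fin.castSucc
  obtain ⟨b, hba, hbJ, hb0, hbs⟩ := exists_zero_of_isRegularZero (J := J) hs
    (a := fun i => algebraMap K R (y i) + algebraMap K R (z i - y i) * t)
    fun i => by simpa [y] using J.mul_mem_left _ htJ
  have hτb : τ ∘ b ∘ Fin.castSucc =
      fun i => algebraMap K _ (y i) + algebraMap K _ (z i - y i) * τ t := by
    rw [hba]
    funext i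
    simp only [Function.comp_apply, map_add, map_mul, AlgHom.commutes]
  have hq' := aeval_line_ne_zero ht (y := y) hz
  choose c hc using fun i => Ultrapower.mkHom_surjective U K (τ (b i))
  obtain hc : Ultrapower.mkHom U K ∘ c = τ ∘ b := funext hc
  have hsol : Ultrapower.mkHom U K ∘ c ∈ (s.map (algebraMap K _)).solutions χ := by
    rw [hc, DLSystem.mem_solutions_map_iff]
    refine ⟨⟨?_, ?_⟩, fun i => ?_⟩
    · rw [MvPolynomial.eval_map, ← MvPolynomial.aeval_def]
      exact (MvPolynomial.comp_aeval_apply b τ _).symm.trans (by rw [hb0, map_zero])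
    · rw [MvPolynomial.pderiv_map, MvPolynomial.eval_map, ← MvPolynomial.aeval_def]
      exact ne_of_eq_of_ne (MvPolynomial.comp_aeval_apply b τ _).symm (hbs.map τ).ne_zero
    · rw [Function.comp_apply, ← τ.commutes, ← map_sub]
      exact (hτ _ (hbJ i)).mem_basicNhd hK hχ _
  rw [← hτb, ← Function.comp_assoc, ← hc, Function.comp_assoc, Ultrapower.aeval_mkHom_comp, ne_eq,
    Ultrapower.mkHom_eq_zero_iff, ← Ultrafilter.eventually_not] at hq'
  obtain ⟨i, hi, hqi⟩ := (((Ultrapower.mem_solutions_diag_iff χ s c).1 hsol).and hq').exists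
  exact ⟨_, ⟨_, hi, rfl⟩, hqi⟩

end Infinitesimal

theorem transcendental_powerSeries_X (K : Type*) [Field K] {σ : Type*} (i : σ) :
    Transcendental K (MvPowerSeries.X i : MvPowerSeries σ K) := by
  rw [← MvPolynomial.coe_X]
  have hcoe : Function.Injective (MvPolynomial.coeToMvPowerSeries.algHom K :
      MvPolynomial σ K →ₐ[K] MvPowerSeries σ K) := MvPolynomial.coe_injective σ K
  exact (isAlgebraic_algHom_iff _ hcoe).not.2 (MvPolynomial.transcendental_X K i)

theorem IsCLarge.exists_arc {L : FirstOrder.Language.{u, v}} {K : Type w} [Field K]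
    [L.Structure K] [TopologicalSpace K] (hK : IsCLarge L K) :
    ∃ (I : Type w) (U : Ultrafilter I) (τ : MvPowerSeries (Fin 1) K →ₐ[K] Ultrapower U K),
      (∀ a ∈ Ideal.span (Set.range MvPowerSeries.X), IsInfinitesimal L K (τ a)) ∧
        Transcendental K (τ (MvPowerSeries.X 0)) := by
  obtain ⟨I, U, -, σ, hσC, hσ⟩ := hK.2 1
  let R := MvPowerSeries (Fin 1) K
  let τ : R →ₐ[K] Ultrapower U K := { σ.comp (algebraMap R (FractionRing R)) with commutes' := hσC }
  have hτ : Function.Injective τ := σ.injective.comp (IsFractionRing.injective R (FractionRing R))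
  have hX : Ideal.span (Set.range MvPowerSeries.X) ≤ IsLocalRing.maximalIdeal R := by
    rw [Ideal.span_le, Set.range_subset_iff]
    intro i
    rw [SetLike.mem_coe, IsLocalRing.mem_maximalIdeal, mem_nonunits_iff,
      MvPowerSeries.isUnit_iff_constantCoeff, MvPowerSeries.constantCoeff_X]
    exact not_isUnit_zero
  exact ⟨I, U, τ, fun a ha => hσ a (hX ha),
    (isAlgebraic_algHom_iff τ hτ).not.2 (transcendental_powerSeries_X K 0)⟩

/-! ### Solving all instances in an ultrapower -/

theorem IsZariskiDense.exists_ultrafilter_algebraicIndependent {F σ : Type w} [Field F]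
    {S : Set (σ → F)} (hS : IsZariskiDense S) :
    ∃ (I : Type w) (U : Ultrafilter I) (a : σ → I → F),
      (∀ i, Function.eval i ∘ a ∈ S) ∧ AlgebraicIndependent F (Ultrapower.mkHom U F ∘ a) := by
  obtain ⟨U, hU⟩ := exists_ultrafilter_forall_eventually_dvd (MvPolynomial σ F)
  choose a haS ha using fun q : {q : MvPolynomial σ F // q ≠ 0} => hS q.1 q.2
  refine ⟨_, U, fun v q => a q v, haS, algebraicIndependent_iff.2 fun q hq => ?_⟩
  by_contra hq0
  rw [Ultrapower.aeval_mkHom_comp, Ultrapower.mkHom_eq_zero_iff] at hq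
  obtain ⟨p, hp, r, hr⟩ := (hq.and (hU q hq0)).exists
  exact ha p (by rw [hr, map_mul]; exact mul_eq_zero_of_left hp _)

section Jets

/-- The tuple `(x, δ x, …, δ^m x)`. -/
def jet {F : Type*} [CommRing F] (δ : Derivation ℤ F F) (m : ℕ) (x : F) : Fin (m + 1) → F :=
  fun i => δ^[i] x

variable {F E : Type*} [CommRing F] [CommRing E]

theorem jet_zero_eq_of_apply_castSucc {δ : Derivation ℤ F F} {m : ℕ} {a : Fin (m + 1) → F}
    (ha : ∀ i : Fin m, δ (a i.castSucc) = a i.succ) : jet δ m (a 0) = a := by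
  ext i
  induction i using Fin.induction with
  | zero => rfl
  | succ i ih => rw [← ha, ← ih, jet, Fin.val_succ, Function.iterate_succ_apply']; rfl

theorem comp_jet {φ : F →+* E} {δ : Derivation ℤ F F} {D : Derivation ℤ E E}
    (h : ∀ x, D (φ x) = φ (δ x)) (m : ℕ) (x : F) : φ ∘ jet δ m x = jet D m (φ x) :=
  funext fun i => (show Function.Semiconj φ δ D from fun x => (h x).symm).iterate_right i x

end Jets

/-- Every instance of (DL) over `F` has a solution in the differential field `(E, D)`, where `E`
is seen as an extension of `F` through `φ`. -/
def SolvesSystems {L : FirstOrder.Language.{u, v}} {k : ℕ} (χ : L.Formula (Fin 1 ⊕ Fin k))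
    {F E : Type w} [Field F] [Field E] [L.Structure E] (φ : F →+* E) (D : Derivation ℤ E E) :
    Prop :=
  ∀ (m : ℕ) (s : DLSystem F k m), s.IsRegular → ∃ x : E, jet D m x ∈ (s.map φ).solutions χ

open Ultrapower in
theorem HasDenseZeros.exists_ultrapower_derivation {L : FirstOrder.Language.{u, v}} {k : ℕ}
    {χ : L.Formula (Fin 1 ⊕ Fin k)} {F : Type w} [Field F] [CharZero F] [L.Structure F]
    (h : HasDenseZeros χ F) (δ : Derivation ℤ F F) :
    ∃ (I : Type w) (U : Ultrafilter I) (D : Derivation ℤ (Ultrapower U F) (Ultrapower U F)),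
      (∀ a, D (algebraMap F _ a) = algebraMap F _ (δ a)) ∧
        SolvesSystems χ (algebraMap F (Ultrapower U F)) D := by
  let J : Type w := Σ m, {s : DLSystem F k m // s.IsRegular}
  obtain ⟨I, U, a, hasol, ha⟩ := (IsZariskiDense.sigma fun j : J =>
    h j.1 j.2.1 j.2.2).exists_ultrafilter_algebraicIndependent
  choose b hb hba using hasol
  let c (j : J) : Fin (j.1 + 1) → Ultrapower U F := mkHom U F ∘ fun v i => b i j v
  have hc (p : Σ j : J, Fin j.1) : c p.1 p.2.castSucc = mkHom U F (a p) :=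
    congrArg (mkHom U F) (funext fun i => congrFun (hba i p.1) p.2)
  obtain ⟨D, hDF, hD⟩ := exists_derivation_of_algebraicIndependent ha
    (fun p => c p.1 p.2.succ) δ
  refine ⟨I, U, D, hDF, fun m s hs => ?_⟩
  let j : J := ⟨m, s, hs⟩
  have hjet : jet D m (c j 0) = c j :=
    jet_zero_eq_of_apply_castSucc fun i => (congrArg D (hc ⟨j, i⟩)).trans (hD ⟨j, i⟩)
  refine ⟨c j 0, ?_⟩
  rw [hjet]
  exact (mem_solutions_diag_iff χ s _).2 (.of_forall fun i => hb i j)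

namespace DiffPoly

variable {K : Type w} [Field K]

theorem pderiv_star (m : ℕ) (P : DiffPoly K) :
    MvPolynomial.pderiv (Fin.last m) (P.star m) = (P.separant m).star m := by
  simp only [star, separant]
  induction P using MvPolynomial.induction_on with
  | C a => simp
  | add p q hp hq => simp only [map_add, hp, hq]
  | mul_X p i hp =>
    simp only [map_mul, Derivation.leibniz, smul_eq_mul, map_add, hp, MvPolynomial.aeval_X]
    congr 2
    obtain rfl | hi := eq_or_ne i m
    · simp [show (⟨i, i.lt_succ_self⟩ : Fin (i + 1)) = Fin.last i from rfl]
    · rw [MvPolynomial.pderiv_X_of_ne hi, map_zero]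
      split_ifs
      · exact MvPolynomial.pderiv_X_of_ne fun h => hi (congrArg Fin.val h)
      · exact map_zero _

theorem eval_jet_star {m : ℕ} {P : DiffPoly K} (hP : ∀ i ∈ P.vars, i ≤ m)
    (δ : Derivation ℤ K K) (x : K) :
    MvPolynomial.eval (jet δ m x) (P.star m) = P.evalAt δ x := by
  rw [star, evalAt, ← MvPolynomial.coe_aeval_eq_eval, RingHom.coe_coe, ← AlgHom.comp_apply,
    MvPolynomial.comp_aeval]
  refine MvPolynomial.eval₂Hom_congr' rfl (fun i hi _ => ?_) rfl
  simp [Nat.lt_succ_of_le (hP i hi), jet]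

theorem vars_separant_subset (m : ℕ) (P : DiffPoly K) : (P.separant m).vars ⊆ P.vars := by
  intro i hi
  obtain ⟨d, hd, hid⟩ := (MvPolynomial.mem_vars_iff_mem_support i).1 hi
  rw [separant, MvPolynomial.mem_support_iff, MvPolynomial.coeff_pderiv] at hd
  refine (MvPolynomial.mem_vars_iff_mem_support i).2
    ⟨_, MvPolynomial.mem_support_iff.2 (left_ne_zero_of_mul hd), ?_⟩
  exact Finsupp.support_mono le_self_add hid

end DiffPoly

theorem SolvesSystems.modelsDL {L : FirstOrder.Language.{u, v}} {k : ℕ}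
    {χ : L.Formula (Fin 1 ⊕ Fin k)} {K : Type w} [Field K] [L.Structure K] {δ : Derivation ℤ K K}
    (h : SolvesSystems χ (RingHom.id K) δ) : ModelsDL χ δ := by
  intro m P hP u y hy hs
  obtain ⟨x, ⟨hx, hsx⟩, hxu⟩ := h m ⟨P.star m, y, u⟩ ⟨hy, by rwa [DiffPoly.pderiv_star]⟩
  rw [DLSystem.map_id] at hx hsx hxu
  rw [DiffPoly.pderiv_star] at hsx
  rw [DiffPoly.eval_jet_star hP.2] at hx
  rw [DiffPoly.eval_jet_star fun i hi => hP.2 i (P.vars_separant_subset m hi)] at hsx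
  exact ⟨x, hx, hsx, hxu⟩

/-! ### Unions of elementary chains -/

section ElementaryChains

variable {L : FirstOrder.Language.{u, v}} {A : Type*} [Preorder A] [IsDirectedOrder A]
  [Nonempty A] {G : A → Type w} [∀ i, L.Structure (G i)] {f : ∀ i j, i ≤ j → G i ↪[L] G j}
  [DirectedSystem G fun i j h => f i j h]

theorem realize_directLimit_of_comp_iff
    (hf : ∀ i j h, ∃ g : G i ↪ₑ[L] G j, g.toEmbedding = f i j h)
    {β : Type*} {n : ℕ} (φ : L.BoundedFormula β n) (i : A) (v : β → G i) (xs : Fin n → G i) :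
    φ.Realize (DirectLimit.of L A G f i ∘ v) (DirectLimit.of L A G f i ∘ xs) ↔
      φ.Realize v xs := by
  induction φ generalizing i with
  | falsum => rfl
  | equal t₁ t₂ =>
    simp only [BoundedFormula.Realize, ← Sum.comp_elim, HomClass.realize_term,
      (DirectLimit.of L A G f i).injective.eq_iff]
  | rel R ts =>
    simp only [BoundedFormula.Realize, ← Sum.comp_elim, HomClass.realize_term]
    exact (DirectLimit.of L A G f i).map_rel R _
  | imp _ _ ih₁ ih₂ => simp only [BoundedFormula.Realize, ih₁, ih₂]
  | all φ ih =>
    simp only [BoundedFormula.Realize]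
    refine ⟨fun h x => ?_, fun h z => ?_⟩
    · rw [← ih, Fin.comp_snoc]
      exact h _
    · obtain ⟨j, z, rfl⟩ := DirectLimit.exists_of z
      obtain ⟨l, hil, hjl⟩ := directed_of (· ≤ ·) i j
      obtain ⟨g, hg⟩ := hf i l hil
      have hgl (y : G i) : DirectLimit.of L A G f i y = DirectLimit.of L A G f l (g y) :=
        DirectLimit.of_f.symm.trans (congrArg _ (DFunLike.congr_fun hg.symm y))
      have hv : DirectLimit.of L A G f i ∘ v = DirectLimit.of L A G f l ∘ g ∘ v :=
        funext fun b => hgl (v b)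
      have hxs : DirectLimit.of L A G f i ∘ xs = DirectLimit.of L A G f l ∘ g ∘ xs :=
        funext fun b => hgl (xs b)
      rw [hv, hxs, ← DirectLimit.of_f (hij := hjl), ← Fin.comp_snoc, ih]
      exact (g.map_boundedFormula φ.all v xs).2 h (f j l hjl z)

/-- The embedding of a component in the direct limit of a system of elementary embeddings. -/
noncomputable def directLimitElementary
    (hf : ∀ i j h, ∃ g : G i ↪ₑ[L] G j, g.toEmbedding = f i j h) (i : A) :
    G i ↪ₑ[L] Language.DirectLimit G f where
  toFun := DirectLimit.of L A G f i
  map_formula' n φ x := by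
    have := realize_directLimit_of_comp_iff hf φ i x default
    rwa [Unique.eq_default (DirectLimit.of L A G f i ∘ default)] at this

end ElementaryChains

theorem exists_union_of_elementary_chain {L : FirstOrder.Language.{u, v}} (G : ℕ → Type w)
    [∀ n, L.Structure (G n)] (e : ∀ n, G n ↪ₑ[L] G (n + 1)) :
    ∃ (M : Type w) (_ : L.Structure M) (j : ∀ n, G n ↪ₑ[L] M),
      (∀ n x, j (n + 1) (e n x) = j n x) ∧
        ∀ T : Set M, T.Finite → ∃ n, T ⊆ Set.range (j n) := by
  let f := DirectedSystem.natLERec (L := L) fun n => (e n).toEmbedding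
  have hself (n : ℕ) : f n n le_rfl = Embedding.refl L (G n) := Nat.leRecOn_self _
  have hsucc (n m : ℕ) (h : n ≤ m) : f n (m + 1) (h.trans m.le_succ) =
      (e m).toEmbedding.comp (f n m h) := Nat.leRecOn_succ h _
  have hf (n m : ℕ) (h : n ≤ m) : ∃ g : G n ↪ₑ[L] G m, g.toEmbedding = f n m h := by
    induction m, h using Nat.le_induction with
    | base => exact ⟨.refl L (G n), (hself n).symm⟩
    | succ m h ih =>
      obtain ⟨g, hg⟩ := ih
      exact ⟨(e m).comp g, by rw [hsucc n m h, ← hg]; rfl⟩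
  refine ⟨Language.DirectLimit G f, inferInstance, directLimitElementary hf, fun n x => ?_,
    fun T hT => ?_⟩
  · have hfn : f n (n + 1) n.le_succ x = e n x := by rw [hsucc n n le_rfl, hself]; rfl
    rw [← hfn]
    exact DirectLimit.of_f (G := G) (f := f)
  · have := hT.to_subtype
    obtain ⟨n, y, hy⟩ := DirectLimit.exists_quotient_mk'_sigma_mk'_eq G f ((↑) : T → _)
    exact ⟨n, fun z hz => ⟨y ⟨z, hz⟩, (congrFun hy ⟨z, hz⟩).symm⟩⟩

theorem exists_derivation_of_directed_union {A R : Type*} [Preorder A] [IsDirectedOrder A]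
    {G : A → Type*} [∀ i, CommRing (G i)] [CommRing R] {J : ∀ i, G i →+* R}
    (hJ : ∀ i, Function.Injective (J i)) (hR : ∀ z, ∃ i x, J i x = z)
    {D : ∀ i, Derivation ℤ (G i) (G i)}
    (hD : ∀ i j, i ≤ j → ∀ x, ∃ y, J j y = J i x ∧ J j (D j y) = J i (D i x)) :
    ∃ δ : Derivation ℤ R R, ∀ i x, δ (J i x) = J i (D i x) := by
  have hpair (z z' : R) : ∃ i x x', J i x = z ∧ J i x' = z' := by
    obtain ⟨i, x, rfl⟩ := hR z
    obtain ⟨i', x', rfl⟩ := hR z'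
    obtain ⟨l, hil, hil'⟩ := directed_of (· ≤ ·) i i'
    obtain ⟨y, hy, -⟩ := hD i l hil x
    obtain ⟨y', hy', -⟩ := hD i' l hil' x'
    exact ⟨l, y, y', hy, hy'⟩
  have hunique (i i' : A) (x : G i) (x' : G i') (h : J i x = J i' x') :
      J i (D i x) = J i' (D i' x') := by
    obtain ⟨l, hil, hil'⟩ := directed_of (· ≤ ·) i i'
    obtain ⟨y, hy, hDy⟩ := hD i l hil x
    obtain ⟨y', hy', hDy'⟩ := hD i' l hil' x'
    rw [← hDy, ← hDy', hJ l (hy.trans (h.trans hy'.symm))]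
  choose level rep hrep using hR
  let d (z : R) : R := J (level z) (D _ (rep z))
  have hd (i : A) (x : G i) : d (J i x) = J i (D i x) := hunique _ _ _ _ (hrep (J i x))
  have hadd (z z' : R) : d (z + z') = d z + d z' := by
    obtain ⟨i, x, x', rfl, rfl⟩ := hpair z z'
    simp only [← map_add, hd]
  have hmul (z z' : R) : d (z * z') = z • d z' + z' • d z := by
    obtain ⟨i, x, x', rfl, rfl⟩ := hpair z z'
    simp only [← map_mul, hd, Derivation.leibniz, smul_eq_mul, map_add]
  exact ⟨Derivation.mk' (AddMonoidHom.mk' d hadd).toIntLinearMap hmul, hd⟩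

namespace IsFieldExpansion

variable {L : FirstOrder.Language.{u, v}} {ι : FirstOrder.Language.ring →ᴸ L} {M N : Type*}
  [Field M] [L.Structure M] [L.Structure N]

/-- The ring homomorphism underlying an embedding of expansions of fields. -/
def ringHom [Field N] (hM : IsFieldExpansion ι M) (hN : IsFieldExpansion ι N) (e : M ↪[L] N) :
    M →+* N where
  toFun := e
  map_one' := by rw [← hM.one, e.map_fun, ← hN.one, Subsingleton.elim (e ∘ _)]
  map_zero' := by rw [← hM.zero, e.map_fun, ← hN.zero, Subsingleton.elim (e ∘ _)]
  map_add' x y := by rw [← hM.add, e.map_fun, comp_vecPair, hN.add]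
  map_mul' x y := by rw [← hM.mul, e.map_fun, comp_vecPair, hN.mul]

theorem onTheory_field_model (hM : IsFieldExpansion ι M) : (ι.onTheory Theory.field).Model M := by
  have hpair (x : Fin 2 → M) : x = ![x 0, x 1] := by ext i; fin_cases i <;> rfl
  have hsingle (x : Fin 1 → M) : x = ![x 0] := by ext i; fin_cases i; rfl
  let : Ring.CompatibleRing M :=
    { ι.reduct M with
      funMap_add x := (congrArg _ (hpair x)).trans (hM.add _ _)
      funMap_mul x := (congrArg _ (hpair x)).trans (hM.mul _ _)
      funMap_neg x := (congrArg _ (hsingle x)).trans (hM.neg _)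
      funMap_zero x := (congrArg _ (Subsingleton.elim _ _)).trans hM.zero
      funMap_one x := (congrArg _ (Subsingleton.elim _ _)).trans hM.one }
  exact (@LHom.onTheory_model _ _ M (ι.reduct M) _ ι _ Theory.field).2 inferInstance

theorem exists_field (hM : IsFieldExpansion ι M) (e : L.ElementarilyEquivalent M N) :
    ∃ _ : Field N, IsFieldExpansion ι N := by
  have hN : (ι.onTheory Theory.field).Model N := e.theory_model_iff.1 hM.onTheory_field_model
  let := ι.reduct N
  have : Theory.field.Model N := (LHom.onTheory_model ι Theory.field).1 hN
  let := Field.fieldOfModelField N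
  exact ⟨_,
    { add _ _ := rfl
      mul _ _ := rfl
      neg _ := rfl
      zero := congrArg (Structure.funMap (ι.onFunction ringFunc.zero)) (Subsingleton.elim _ _)
      one := congrArg (Structure.funMap (ι.onFunction ringFunc.one)) (Subsingleton.elim _ _) }⟩

end IsFieldExpansion

theorem DLSystem.exists_finite_forall_mem_range_map {S : Type w} [CommSemiring S] {k m : ℕ}
    (s : DLSystem S k m) : ∃ T : Set S, T.Finite ∧ ∀ {R : Type w} [CommSemiring R] (φ : R →+* S),
      T ⊆ Set.range φ → s ∈ Set.range (map φ : DLSystem R k m → DLSystem S k m) := by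
  refine ⟨s.poly.coeffs ∪ Set.range s.center ∪ ⋃ i, Set.range (s.radius i),
    (s.poly.coeffs.finite_toSet.union (Set.finite_range _)).union
      (Set.finite_iUnion fun _ => Set.finite_range _), fun φ hφ => ?_⟩
  rw [Set.union_subset_iff, Set.union_subset_iff, Set.iUnion_subset_iff] at hφ
  obtain ⟨⟨hpoly, hcenter⟩, hradius⟩ := hφ
  obtain ⟨f, hf⟩ := MvPolynomial.mem_range_map_iff_coeffs_subset.2 hpoly
  obtain ⟨y, hy⟩ := Set.range_subset_range_iff_exists_comp.1 hcenter
  choose r hr using fun i => Set.range_subset_range_iff_exists_comp.1 (hradius i)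
  refine ⟨⟨f, y, r⟩, ?_⟩
  cases s
  exact congr (congr (congrArg mk hf) hy.symm) (funext fun i => (hr i).symm)

theorem DLSystem.comp_mem_solutions_map_iff {L : FirstOrder.Language.{u, v}} {k m : ℕ}
    (χ : L.Formula (Fin 1 ⊕ Fin k)) {M N : Type w} [Field M] [L.Structure M] [Field N]
    [L.Structure N] {φ : M →+* N} {e : M ↪ₑ[L] N} (he : ⇑e = φ) (s : DLSystem M k m)
    (a : Fin (m + 1) → M) : φ ∘ a ∈ (s.map φ).solutions χ ↔ a ∈ s.solutions χ := by
  have hnhd (x : M) (b : Fin k → M) : φ x ∈ basicNhd χ N (φ ∘ b) ↔ x ∈ basicNhd χ M b := by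
    rw [mem_basicNhd_comp_iff, ← he]
    exact e.map_formula χ _
  simp only [mem_solutions_map_iff, isRegularZero_map_iff φ.injective, Function.comp_apply,
    ← map_sub, hnhd]
  rfl

/-- A structure expanding a field of characteristic zero in which (DL) has densely many
solutions, together with a derivation. These are the stages of the elementary chain. -/
structure DenseDiffField {L : FirstOrder.Language.{u, v}} (ι : FirstOrder.Language.ring →ᴸ L)
    {k : ℕ} (χ : L.Formula (Fin 1 ⊕ Fin k)) where
  carrier : Type w
  [field : Field carrier]
  [str : L.Structure carrier]
  [charZero : CharZero carrier]
  deriv : Derivation ℤ carrier carrier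
  isFieldExpansion : IsFieldExpansion ι carrier
  hasDenseZeros : HasDenseZeros χ carrier

namespace DenseDiffField

attribute [instance] field str charZero

variable {L : FirstOrder.Language.{u, v}} {ι : FirstOrder.Language.ring →ᴸ L} {k : ℕ}
  {χ : L.Formula (Fin 1 ⊕ Fin k)}

theorem exists_solvesSystems (S : DenseDiffField.{u, v, w} ι χ) :
    ∃ (T : DenseDiffField.{u, v, w} ι χ) (e : S.carrier ↪ₑ[L] T.carrier),
      (∀ x, e (S.deriv x) = T.deriv (e x)) ∧
        SolvesSystems χ (S.isFieldExpansion.ringHom T.isFieldExpansion e.toEmbedding) T.deriv := by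
  obtain ⟨I, U, D, hD, hsol⟩ := S.hasDenseZeros.exists_ultrapower_derivation S.deriv
  have : CharZero (Ultrapower U S.carrier) :=
    charZero_of_injective_algebraMap (algebraMap S.carrier (Ultrapower U S.carrier)).injective
  exact ⟨{ carrier := Ultrapower U S.carrier
           deriv := D
           isFieldExpansion := Ultrapower.isFieldExpansion S.isFieldExpansion
           hasDenseZeros := S.hasDenseZeros.ultrapower U },
    Ultrapower.diagElementary U S.carrier L, fun x => (hD x).symm, hsol⟩

theorem exists_chain (S : DenseDiffField.{u, v, w} ι χ) :
    ∃ (G : ℕ → DenseDiffField.{u, v, w} ι χ)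
      (e : ∀ n, (G n).carrier ↪ₑ[L] (G (n + 1)).carrier), G 0 = S ∧
      (∀ n x, e n ((G n).deriv x) = (G (n + 1)).deriv (e n x)) ∧
      ∀ n, SolvesSystems χ ((G n).isFieldExpansion.ringHom (G (n + 1)).isFieldExpansion
        (e n).toEmbedding) (G (n + 1)).deriv := by
  choose next e he hsol using exists_solvesSystems (ι := ι) (χ := χ)
  let G (n : ℕ) : DenseDiffField.{u, v, w} ι χ := n.rec S fun _ => next
  exact ⟨G, fun n => e (G n), rfl, fun n => he (G n), fun n => hsol (G n)⟩

end DenseDiffField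

theorem solvesSystems_of_chain {L : FirstOrder.Language.{u, v}} {k : ℕ}
    {χ : L.Formula (Fin 1 ⊕ Fin k)} {G : ℕ → Type w} [∀ n, Field (G n)] [∀ n, L.Structure (G n)]
    {D : ∀ n, Derivation ℤ (G n) (G n)} {φ : ∀ n, G n →+* G (n + 1)}
    (hsol : ∀ n, SolvesSystems χ (φ n) (D (n + 1)))
    {M : Type w} [Field M] [L.Structure M] {δ : Derivation ℤ M M} {J : ∀ n, G n →+* M}
    (hJ : ∀ n, ∃ j : G n ↪ₑ[L] M, ⇑j = J n)
    (hφ : ∀ n, (J (n + 1)).comp (φ n) = J n)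
    (hδ : ∀ n x, δ (J n x) = J n (D n x))
    (hM : ∀ T : Set M, T.Finite → ∃ n, T ⊆ Set.range (J n)) :
    SolvesSystems χ (RingHom.id M) δ := by
  intro m s hs
  obtain ⟨T, hT, hTs⟩ := s.exists_finite_forall_mem_range_map
  obtain ⟨n, hn⟩ := hM T hT
  obtain ⟨s, rfl⟩ := hTs (J n) hn
  obtain ⟨x, hx⟩ := hsol n m s ((isRegularZero_map_iff (J n).injective).1 hs)
  obtain ⟨j, hj⟩ := hJ (n + 1)
  refine ⟨J (n + 1) x, ?_⟩
  rw [DLSystem.map_id, ← hφ n, ← DLSystem.map_map, ← comp_jet (hδ (n + 1)),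
    DLSystem.comp_mem_solutions_map_iff χ hj]
  exact hx

theorem DenseDiffField.exists_modelsDL {L : FirstOrder.Language.{u, v}}
    {ι : FirstOrder.Language.ring →ᴸ L} {k : ℕ} {χ : L.Formula (Fin 1 ⊕ Fin k)}
    (S : DenseDiffField.{u, v, w} ι χ) :
    ∃ (M : Type w) (_ : Field M) (_ : L.Structure M) (δ : Derivation ℤ M M)
      (j : S.carrier ↪ₑ[L] M),
      IsFieldExpansion ι M ∧ (∀ x, j (S.deriv x) = δ (j x)) ∧ ModelsDL χ δ := by
  obtain ⟨G, e, rfl, he, hsol⟩ := S.exists_chain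
  obtain ⟨M, _, j, hje, hfin⟩ := exists_union_of_elementary_chain (fun n => (G n).carrier) e
  obtain ⟨_, hM⟩ := (G 0).isFieldExpansion.exists_field (j 0).elementarilyEquivalent
  let J (n : ℕ) : (G n).carrier →+* M := (G n).isFieldExpansion.ringHom hM (j n).toEmbedding
  have hD (n m : ℕ) (h : n ≤ m) (x : (G n).carrier) :
      ∃ y, J m y = J n x ∧ J m ((G m).deriv y) = J n ((G n).deriv x) := by
    induction m, h using Nat.le_induction with
    | base => exact ⟨x, rfl, rfl⟩
    | succ m _ ih =>
      obtain ⟨y, hy, hDy⟩ := ih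
      exact ⟨e m y, (hje m y).trans hy,
        (congrArg _ (he m y)).symm.trans ((hje m ((G m).deriv y)).trans hDy)⟩
  obtain ⟨δ, hδ⟩ := exists_derivation_of_directed_union (J := J) (fun n => (J n).injective)
    (fun z => (hfin {z} (Set.finite_singleton z)).imp fun n hn => hn rfl) hD
  have hsolM : SolvesSystems χ (RingHom.id M) δ :=
    solvesSystems_of_chain (G := fun n => (G n).carrier) (D := fun n => (G n).deriv) (J := J)
      hsol (fun n => ⟨j n, rfl⟩) (fun n => RingHom.ext (hje n)) hδ hfin
  exact ⟨M, _, _, δ, j 0, hM, fun x => (hδ 0 x).symm, hsolM.modelsDL⟩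

theorem mainTheorem6_general {L : FirstOrder.Language.{u, v}} (ι : FirstOrder.Language.ring →ᴸ L)
    (K : Type w) [Field K] [CharZero K] [L.Structure K] (hK : IsFieldExpansion ι K)
    [TopologicalSpace K] [IsTopologicalAddGroup K]
    {k : ℕ} (χ : L.Formula (Fin 1 ⊕ Fin k)) (hχ : IsNhdBasisFormula χ K)
    (δ : Derivation ℤ K K) {I : Type w} {U : Ultrafilter I} {R : Type*} [CommRing R]
    [Algebra K R] {J : Ideal R} [HenselianRing R J] (τ : R →ₐ[K] Ultrapower U K)
    (hτ : ∀ a ∈ J, IsInfinitesimal L K (τ a)) {t : R} (htJ : t ∈ J)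
    (ht : Transcendental K (τ t)) :
    ∃ (K' : Type w) (_ : Field K') (_ : L.Structure K') (δ' : Derivation ℤ K' K')
      (j : K ↪ₑ[L] K'),
      IsFieldExpansion ι K' ∧ (∀ x : K, j (δ x) = δ' (j x)) ∧ ModelsDL χ δ' :=
  DenseDiffField.exists_modelsDL
    { carrier := K
      deriv := δ
      isFieldExpansion := hK
      hasDenseZeros := hasDenseZeros_of_henselianRing hK hχ τ hτ htJ ht }

theorem mainTheorem6 {L : FirstOrder.Language.{u, v}} (ι : FirstOrder.Language.ring →ᴸ L)
    (K : Type w) [Field K] [CharZero K] [L.Structure K] (hK : IsFieldExpansion ι K)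
    [TopologicalSpace K] [IsTopologicalDivisionRing K]
    {k : ℕ} (χ : L.Formula (Fin 1 ⊕ Fin k)) (hχ : IsNhdBasisFormula χ K)
    (δ : Derivation ℤ K K) (hc : IsCLarge L K) :
    ∃ (K' : Type w) (_ : Field K') (_ : L.Structure K') (δ' : Derivation ℤ K' K')
      (j : K ↪[L] K'),
      IsFieldExpansion ι K' ∧
      L.ElementarilyEquivalent K K' ∧
      (∀ x : K, j (δ x) = δ' (j x)) ∧
      ModelsDL χ δ' := by
  obtain ⟨I, U, τ, hτ, hX⟩ := hc.exists_arc
  obtain ⟨K', _, _, δ', j, hK', hj, hDL⟩ := mainTheorem6_general ι K hK χ hχ δ τ hτ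
    (Ideal.subset_span (Set.mem_range_self 0)) hX
  exact ⟨K', _, _, δ', j.toEmbedding, hK', j.elementarilyEquivalent, hj, hDL⟩
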